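/- All spaces are real. For subspaces $V,W$ of a Banach space $Z$ with unit sphere $S(Z)$, the gap is $$\gamma(V,W)=\max\Big\{\sup_{v\in V\cap S(Z)}\operatorname{dist}(v,W),\ \sup_{w\in W\cap S(Z)}\operatorname{dist}(w,V)\Big\},$$ with $\sup\emptyset=0$. For a separable Banach space $Z$ define the following classes of subsets of $Z$. - For a finite-dimensional subspace $V\subset Z$, $\mathcal A(V)$ is the class of all Borel sets $B\subset Z$ such that $V\cap(B+a)$ is Lebesgue null in $V$ for every $a\in Z$; for $0\ne v\in Z$, $\mathcal A(v):=\mathcal A(\mathrm{sp}\{v\})$. - For $V$ finite-dimensional and $0<\varepsilon<1$, $\mathcal A^*(V,\varepsilon)$ is the class of all Borel sets $B\subset Z$ with $B\in\mathcal A(W)$ for every finite-dimensional subspace $W$ with $\gamma(V,W)<\varepsilon$; $\mathcal A^*(V)$ is the class of all sets $\bigcup_{k=1}^\infty B_k$ with $B_k\in\mathcal A^*(V,\varepsilon_k)$ for some $0<\varepsilon_k<1$. - For $d\in\mathbb N$, $\mathcal C^*_d$ is the class of all sets $\bigcup_{k=1}^\infty B_k$ where each $B_k$ belongs to $\mathcal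 A^*(V_k)$ for some subspace $V_k$ with $\dim V_k=d$. - A set $B\subset Z$ is Aronszajn null if, for every sequence $(v_k)$ of nonzero vectors with dense linear span in $Z$, one can write $B=\bigcup_{k=1}^\infty B_k$ with $B_k\in\mathcal A(v_k)$ for each $k$. **Theorem.** Let $X$ be a separable infinite-dimensional Banach space, let $n\ge 2$, and let $T:X\to X^*$ be a monotone multivalued operator, i.e. $T(x)\subset X^*$ (possibly empty) for each $x\in X$, and $\langle x^*-y^*,x-y\rangle\ge 0$ whenever $x^*\in T(x)$, $y^*\in T(y)$. Let $B_n$ be the set of all $x\in X$ for which the convex hull of $T(x)$ is at least $n$-dimensional (its affine hull has dimension at least $n$). Let $P:X\to Y$ be a continuous linear mapping onto a Banach space $Y$ with $\dim\ker P<n$. Then $P(B_n)$ is a subset of a set from $\mathcal C^*_n$ in $Y$. Moreover, $P(B_n)$ is a first category (meager) subset of $Y$, and it is a subset of an Aronszajn null set in $Y$. -/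

import Mathlib

open MeasureTheory

namespace MonotoneProjection

section Gap

variable {X : Type*} [NormedAddCommGroup X] [NormedSpace ℝ X]

/-- The one-sided quantity `sup {dist (y, W) : y ∈ V, ‖y‖ = 1}`. The set of values is bounded
by `1`, and for `V = {0}` the supremum of the empty set of reals is `0`. -/
noncomputable def halfGap (V W : Submodule ℝ X) : ℝ :=
  sSup ((fun y : X => Metric.infDist y (W : Set X)) '' {y : X | y ∈ V ∧ ‖y‖ = 1})

/-- The gap `γ(V, W)` between two subspaces of a normed space. This formula also gives the
conventional values `γ({0}, {0}) = 0` and `γ(V, W) = 1` if exactly one of `V`, `W` is `{0}`. -/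
noncomputable def gap (V W : Submodule ℝ X) : ℝ :=
  max (halfGap V W) (halfGap W V)

end Gap

section NullClasses

variable {X : Type*} [NormedAddCommGroup X] [NormedSpace ℝ X] [MeasurableSpace X] [BorelSpace X]

/-- `𝒜(V)`: the Borel sets `B` such that `V ∩ (B + a)` is Lebesgue null in the
finite-dimensional space `V`, for every `a ∈ X`. Lebesgue measure on `V` is determined up to a
positive factor as the Haar measure of `V`. -/
def classA (V : Submodule ℝ X) [FiniteDimensional ℝ V] : Set (Set X) :=
  {B | MeasurableSet B ∧
    ∀ a : X, (Measure.addHaar : Measure V)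
      (((↑) : V → X) ⁻¹' ((fun b : X => b + a) '' B)) = 0}

/-- `𝒜*(V, ε)`, used for `V` finite-dimensional and `0 < ε < 1`: the Borel sets that belong to
`𝒜(W)` for each (finite-dimensional) subspace `W` with `γ(V, W) < ε`. -/
def classAStarEps (V : Submodule ℝ X) (ε : ℝ) : Set (Set X) :=
  {B | MeasurableSet B ∧
    ∀ (W : Submodule ℝ X) [FiniteDimensional ℝ W], gap V W < ε → B ∈ classA W}

/-- `𝒜*(V)`: countable unions of sets `B k ∈ 𝒜*(V, ε k)` with `0 < ε k < 1`. -/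
def classAStar (V : Submodule ℝ X) : Set (Set X) :=
  {B | ∃ (C : ℕ → Set X) (ε : ℕ → ℝ),
    (∀ k, 0 < ε k ∧ ε k < 1 ∧ C k ∈ classAStarEps V (ε k)) ∧ B = ⋃ k, C k}

variable (X) in
/-- `𝒞*_d` in `X`: countable unions of sets `C k ∈ 𝒜*(V k)` with `dim V k = d`. -/
def classCStar (d : ℕ) : Set (Set X) :=
  {B | ∃ (C : ℕ → Set X) (V : ℕ → Submodule ℝ X),
    (∀ k, FiniteDimensional ℝ (V k) ∧ Module.finrank ℝ (V k) = d ∧ C k ∈ classAStar (V k)) ∧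
      B = ⋃ k, C k}

variable (X) in
/-- The Aronszajn null sets of `X`: those `B` that, for every complete sequence `v` of nonzero
vectors (the linear span of `v` is dense in `X`), can be written as the union of sets
`C k ∈ 𝒜(sp {v k})`. -/
def aronszajnNull : Set (Set X) :=
  {B | ∀ v : ℕ → X, (∀ k, v k ≠ 0) → Dense (Submodule.span ℝ (Set.range v) : Set X) →
    ∃ C : ℕ → Set X, (∀ k, C k ∈ classA (Submodule.span ℝ {v k})) ∧ B = ⋃ k, C k}

end NullClasses

section MonotoneOperators

variable {X : Type*} [NormedAddCommGroup X] [NormedSpace ℝ X]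

/-- A multivalued operator `T : X → X*` (values may be empty) is monotone. -/
def IsMonotoneOperator (T : X → Set (StrongDual ℝ X)) : Prop :=
  ∀ x y : X, ∀ x' ∈ T x, ∀ y' ∈ T y, 0 ≤ (x' - y') (x - y)

/-- The set of all `x` for which the convex hull of `T x` is at least `n`-dimensional; the
dimension of a convex set is that of its affine hull. -/
def multiplicitySet (T : X → Set (StrongDual ℝ X)) (n : ℕ) : Set X :=
  {x | (n : Cardinal) ≤ Module.rank ℝ (vectorSpan ℝ (convexHull ℝ (T x)))}

end MonotoneOperators

end MonotoneProjection

/-! Suppose `T x` and `T y` contain functionals of norm at most `R` whose values at vectors `u j`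
surround the same ball of radius `r`. Testing monotonicity on opposite faces of that ball shows that
`x - y` avoids a cone around the span of `u` (`coneBound_ballSet`). Countably many such pieces cover
the multiplicity set. Each is a Lipschitz graph over a complement of an `n`-dimensional space, so it
has codimension `n`, while `P` lowers the dimension of the ambient space by less than `n`. Hence the
image is null along every finite-dimensional `W` containing all `P (u j)`
(`ConeBound.image_mem_classA`). The cone condition passes to closures and survives small changes of
`u`, so the images may be taken closed and `W` need only pass near each `P (u j)`
(`ConeBound.exists_image_mem_classA`). All three conclusions follow: gap-neighbourhoods of an
`n`-dimensional space give `classCStar`; a closed null set has empty interior; and the span of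
finitely many terms of a complete sequence is an admissible `W`, along which Fubini splits the set
into directional pieces. -/

namespace MonotoneProjection

/-! ### The cone condition and its stability. -/

section Cone

variable {X : Type*} [NormedAddCommGroup X] [NormedSpace ℝ X] {n : ℕ}

/-- The differences of points of `A` avoid a cone around the span of the vectors `u j`:
the coefficients `c` are controlled by the distance of `x - y` to `∑ j, c j • u j`. -/
def ConeBound (u : Fin n → X) (L : ℝ) (A : Set X) : Prop :=
  ∀ x ∈ A, ∀ y ∈ A, ∀ c : Fin n → ℝ, ‖c‖ ≤ L * ‖x - y - ∑ j, c j • u j‖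

theorem ConeBound.closure {u : Fin n → X} {L : ℝ} {A : Set X} (h : ConeBound u L A) :
    ConeBound u L (closure A) := by
  intro x hx y hy c
  have hcl : IsClosed {p : X × X | ‖c‖ ≤ L * ‖p.1 - p.2 - ∑ j, c j • u j‖} :=
    isClosed_le continuous_const (by fun_prop)
  have hsub : A ×ˢ A ⊆ {p : X × X | ‖c‖ ≤ L * ‖p.1 - p.2 - ∑ j, c j • u j‖} :=
    fun p hp => h p.1 hp.1 p.2 hp.2 c
  have hmem : (x, y) ∈ _root_.closure (A ×ˢ A) := by
    rw [closure_prod_eq]; exact ⟨hx, hy⟩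
  exact closure_minimal hsub hcl hmem

theorem norm_sum_smul_le {u : Fin n → X} {δ : ℝ} (hu : ∀ j, ‖u j‖ ≤ δ)
    (c : Fin n → ℝ) : ‖∑ j, c j • u j‖ ≤ n * δ * ‖c‖ := by
  calc ‖∑ j, c j • u j‖ ≤ ∑ j, ‖c j • u j‖ := norm_sum_le _ _
    _ ≤ ∑ _j : Fin n, ‖c‖ * δ := by
        refine Finset.sum_le_sum fun j _ => ?_
        rw [norm_smul]
        exact mul_le_mul (norm_le_pi_norm c j) (hu j) (norm_nonneg _) (norm_nonneg _)
    _ = n * δ * ‖c‖ := by simp; ring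

/-- The error term is at most `L * n * δ * ‖c‖ ≤ ‖c‖ / 2`; absorbing it on the left doubles the
constant. -/
theorem ConeBound.perturb {u u' : Fin n → X} {L δ : ℝ} {A : Set X} (h : ConeBound u L A)
    (hL : 0 ≤ L) (hδ : L * (n * δ) ≤ 1 / 2) (hu : ∀ j, ‖u' j - u j‖ ≤ δ) :
    ConeBound u' (2 * L) A := by
  intro x hx y hy c
  have h1 := h x hx y hy c
  have h2 : x - y - ∑ j, c j • u j = (x - y - ∑ j, c j • u' j) + ∑ j, c j • (u' j - u j) := by
    simp [smul_sub]
  have h3 := norm_add_le (x - y - ∑ j, c j • u' j) (∑ j, c j • (u' j - u j))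
  have h4 := norm_sum_smul_le hu c
  rw [h2] at h1
  have h5 := mul_le_mul_of_nonneg_left (h3.trans (add_le_add_right h4 _)) hL
  have h6 := mul_le_mul_of_nonneg_right hδ (norm_nonneg c)
  nlinarith

theorem ConeBound.linearIndependent {u : Fin n → X} {L : ℝ} {A : Set X} (h : ConeBound u L A)
    (hA : A.Nonempty) : LinearIndependent ℝ u := by
  obtain ⟨x, hx⟩ := hA
  rw [Fintype.linearIndependent_iff]
  intro c hc j
  have h1 := h x hx x hx c
  rw [hc] at h1
  simp only [sub_self, norm_zero, mul_zero, norm_le_zero_iff] at h1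
  simp [h1]

end Cone

/-! ### Covering the multiplicity set by countably many cone-bounded pieces. -/

section Cover

variable {X : Type*} [NormedAddCommGroup X] [NormedSpace ℝ X] {n : ℕ}

/-- Evaluation of functionals at finitely many vectors. -/
noncomputable def evalAt (u : Fin n → X) : StrongDual ℝ X →ₗ[ℝ] (Fin n → ℝ) where
  toFun f j := f (u j)
  map_add' _ _ := rfl
  map_smul' _ _ := rfl

theorem sum_mul_evalAt (u : Fin n → X) (f : StrongDual ℝ X) (c : Fin n → ℝ) :
    f (∑ j, c j • u j) = ∑ j, evalAt u f j * c j := by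
  simp [evalAt, mul_comm]

/-- The joint map `x ↦ (g i x)` is onto: a nonzero functional killing its range would be a linear
relation among the `g i`. -/
theorem exists_evalAt_eq_single {g : Fin n → StrongDual ℝ X} (hg : LinearIndependent ℝ g) :
    ∃ u : Fin n → X, ∀ i, evalAt u (g i) = Pi.single i 1 := by
  classical
  let G : X →ₗ[ℝ] (Fin n → ℝ) := LinearMap.pi fun i => (g i : X →ₗ[ℝ] ℝ)
  have hG : Function.Surjective G := by
    rw [← LinearMap.range_eq_top]
    by_contra hne
    obtain ⟨f, hf, hle⟩ := Submodule.exists_le_ker_of_lt_top _ (lt_top_iff_ne_top.2 hne)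
    apply hf
    have h0 : ∑ i, f (Pi.single i 1) • g i = 0 := by
      ext x
      have h1 : f (G x) = 0 := hle ⟨x, rfl⟩
      rw [LinearMap.pi_apply_eq_sum_univ] at h1
      have h2 : ∀ i : Fin n, (fun j => if i = j then (1 : ℝ) else 0) = Pi.single i 1 := by
        intro i; ext j; simp [Pi.single_apply, eq_comm]
      simp only [h2] at h1
      simpa [G, mul_comm] using h1
    have h2 := Fintype.linearIndependent_iff.1 hg _ h0
    refine LinearMap.pi_ext' fun i => LinearMap.ext_ring ?_
    simpa using h2 i
  choose u hu using fun j => hG (Pi.single j 1)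
  refine ⟨u, fun i => ?_⟩
  ext j
  have := congrFun (hu j) i
  simp only [G, LinearMap.pi_apply] at this
  change g i (u j) = _
  rw [show g i (u j) = _ from this, Pi.single_apply, Pi.single_apply]
  simp [eq_comm]

theorem isOpen_linearIndependent_evalAt (g : Fin n → StrongDual ℝ X) :
    IsOpen {u : Fin n → X | LinearIndependent ℝ fun i => evalAt u (g i)} := by
  have hc : Continuous fun (u : Fin n → X) (i : Fin n) => evalAt u (g i) := by
    refine continuous_pi fun i => continuous_pi fun j => ?_
    exact (g i).continuous.comp (continuous_apply j)
  exact isOpen_setOfPred_linearIndependent.preimage hc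

theorem affineSpan_image_evalAt_eq_top {S : Set (StrongDual ℝ X)} (hS : S.Nonempty)
    {g : Fin n → StrongDual ℝ X} (hg : ∀ i, g i ∈ vectorSpan ℝ S) {u : Fin n → X}
    (hu : LinearIndependent ℝ fun i => evalAt u (g i)) :
    affineSpan ℝ (evalAt u '' S) = ⊤ := by
  rw [AffineSubspace.affineSpan_eq_top_iff_vectorSpan_eq_top_of_nonempty _ _ _ (hS.image _)]
  have h1 := AffineMap.map_vectorSpan (evalAt u).toAffineMap (s := S)
  have h2 : vectorSpan ℝ (evalAt u '' S) = (vectorSpan ℝ S).map (evalAt u) := by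
    simpa using h1.symm
  rw [h2, eq_top_iff, ← hu.span_eq_top_of_card_eq_finrank' (by simp), Submodule.span_le]
  rintro _ ⟨i, rfl⟩
  exact Submodule.mem_map_of_mem (hg i)

/-- A subset of the image with full affine hull can be taken bounded. -/
theorem exists_affineSpan_image_inter_closedBall_eq_top {S : Set (StrongDual ℝ X)}
    {u : Fin n → X} (h : affineSpan ℝ (evalAt u '' S) = ⊤) :
    ∃ M : ℕ, ∀ R : ℝ, M ≤ R →
      affineSpan ℝ (evalAt u '' (S ∩ Metric.closedBall 0 R)) = ⊤ := by
  have h1 : ∃ t ⊆ evalAt u '' S, t.Finite ∧ affineSpan ℝ t = ⊤ := by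
    obtain ⟨t, hts, hspan, hind⟩ := exists_affineIndependent ℝ (Fin n → ℝ) (evalAt u '' S)
    exact ⟨t, hts, finite_set_of_fin_dim_affineIndependent ℝ hind, hspan.trans h⟩
  obtain ⟨t, htS, htfin, ht⟩ := Set.exists_subset_image_finite_and.1 h1
  obtain ⟨R, hR⟩ := htfin.isBounded.subset_closedBall (0 : StrongDual ℝ X)
  obtain ⟨M, hM⟩ := exists_nat_ge R
  refine ⟨M, fun R' hR' => ?_⟩
  rw [eq_top_iff, ← ht]
  exact affineSpan_mono ℝ (Set.image_mono (Set.subset_inter htS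
    (hR.trans (Metric.closedBall_subset_closedBall (hM.trans hR')))))

/-- Points `x` in a ball at which the images under `evalAt u` of boundedly many elements of `T x`
surround a fixed ball. -/
def ballSet (T : X → Set (StrongDual ℝ X)) (u : Fin n → X) (q : Fin n → ℝ) (r R : ℝ) : Set X :=
  {x | ‖x‖ ≤ R ∧
    Metric.closedBall q r ⊆ convexHull ℝ (evalAt u '' (T x ∩ Metric.closedBall 0 R))}

theorem exists_mem_inner_ge {S : Set (StrongDual ℝ X)} {u : Fin n → X} {p : Fin n → ℝ}
    (hp : p ∈ convexHull ℝ (evalAt u '' S)) (c : Fin n → ℝ) :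
    ∃ f ∈ S, ∑ j, p j * c j ≤ f (∑ j, c j • u j) := by
  let l : (Fin n → ℝ) →ₗ[ℝ] ℝ :=
    { toFun := fun p => ∑ j, p j * c j
      map_add' := fun a b => by simp [add_mul, Finset.sum_add_distrib]
      map_smul' := fun a b => by simp [Finset.mul_sum, mul_assoc] }
  obtain ⟨_, ⟨f, hf, rfl⟩, hle⟩ :=
    (l.convexOn (convex_univ (𝕜 := ℝ))).exists_ge_of_mem_convexHull (Set.subset_univ _) hp
  refine ⟨f, hf, ?_⟩
  rw [sum_mul_evalAt]
  exact hle

/-- With `v = ∑ c j • u j`, pick `g ∈ T y` with `g v ≥ ⟨q, c⟩ + r|c j|` and `f ∈ T x` with `f v ≤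
⟨q, c⟩ - r|c j|`. Then `0 ≤ (f - g) (x - y) ≤ -2r|c j| + 2R‖x - y - v‖`. -/
theorem coneBound_ballSet {T : X → Set (StrongDual ℝ X)} (hT : IsMonotoneOperator T)
    (u : Fin n → X) (q : Fin n → ℝ) {r R : ℝ} (hr : 0 < r) (hR : 0 ≤ R) :
    ConeBound u (R / r) (ballSet T u q r R) := by
  classical
  intro x hx y hy c
  set v := ∑ j, c j • u j with hv
  have hnn : 0 ≤ R / r * ‖x - y - v‖ := by positivity
  refine (pi_norm_le_iff_of_nonneg hnn).2 fun j => ?_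
  set s : ℝ := r * SignType.sign (c j) with hs
  have hsr : |s| ≤ r := by
    rw [hs, abs_mul, abs_of_pos hr]
    rcases lt_trichotomy (c j) 0 with h | h | h <;> simp [h, hr.le]
  have hsc : s * c j = r * |c j| := by
    rw [hs, mul_assoc, sign_mul_self]
  have hball : ∀ t : ℝ, |t| ≤ r → q + Pi.single j t ∈ Metric.closedBall q r := by
    intro t ht
    rw [mem_closedBall_iff_norm, add_sub_cancel_left, Pi.norm_single]
    exact ht
  have hval : ∀ t : ℝ, ∑ i, (q + Pi.single j t : Fin n → ℝ) i * c i
      = ∑ i, q i * c i + t * c j := by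
    intro t
    simp [add_mul, Finset.sum_add_distrib, Pi.single_apply]
  obtain ⟨g, hg, hgle⟩ := exists_mem_inner_ge (hy.2 (hball s hsr)) c
  obtain ⟨f, hf, hfle⟩ := exists_mem_inner_ge (hx.2 (hball (-s) (by rwa [abs_neg]))) (-c)
  rw [hval] at hgle
  have hfle' : f v ≤ ∑ i, q i * c i - r * |c j| := by
    simp only [Pi.neg_apply, mul_neg, Finset.sum_neg_distrib, neg_smul, map_neg, hval, ← hv]
      at hfle
    linarith
  rw [hsc] at hgle
  have hmon := hT x y f hf.1 g hg.1
  have hsplit : (f - g) (x - y) = (f v - g v) + (f - g) (x - y - v) := by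
    simp; ring
  have hfg : ‖f - g‖ ≤ 2 * R := by
    have h1 := mem_closedBall_zero_iff.1 hf.2
    have h2 := mem_closedBall_zero_iff.1 hg.2
    linarith [norm_sub_le f g]
  have hop : (f - g) (x - y - v) ≤ 2 * R * ‖x - y - v‖ :=
    (le_abs_self _).trans (((f - g).le_opNorm _).trans
      (mul_le_mul_of_nonneg_right hfg (norm_nonneg _)))
  rw [Real.norm_eq_abs, div_mul_eq_mul_div, le_div_iff₀ hr]
  linarith

theorem exists_linearIndependent_mem_of_le_rank {V : Type*} [AddCommGroup V] [Module ℝ V]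
    (W : Submodule ℝ V) {n : ℕ} (h : (n : Cardinal) ≤ Module.rank ℝ W) :
    ∃ g : Fin n → V, (∀ i, g i ∈ W) ∧ LinearIndependent ℝ g := by
  obtain ⟨g, hg⟩ := Module.le_rank_iff.1 h
  exact ⟨fun i => g i, fun i => (g i).2, hg.map' W.subtype W.ker_subtype⟩

theorem multiplicitySet_subset_iUnion_ballSet (hn : 0 < n) (T : X → Set (StrongDual ℝ X))
    {U : ℕ → Fin n → X} (hU : DenseRange U) {Q : ℕ → Fin n → ℝ} (hQ : DenseRange Q) :
    multiplicitySet T n ⊆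
      ⋃ i : ℕ × ℕ × ℕ, ballSet T (U i.1) (Q i.2.1) (1 / (i.2.2 + 1)) i.2.2 := by
  intro x hx
  have hx' : (n : Cardinal) ≤ Module.rank ℝ (vectorSpan ℝ (T x)) := by
    have h1 : vectorSpan ℝ (convexHull ℝ (T x)) = vectorSpan ℝ (T x) := by
      rw [← direction_affineSpan, affineSpan_convexHull, direction_affineSpan]
    rw [← h1]; exact hx
  -- Positivity of `n` rules out empty values, whose vector span has rank `0`.
  have hne : (T x).Nonempty := by
    by_contra hemp
    rw [Set.not_nonempty_iff_eq_empty] at hemp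
    rw [hemp, vectorSpan_empty] at hx'
    simp at hx'
    omega
  obtain ⟨g, hgT, hg⟩ := exists_linearIndependent_mem_of_le_rank _ hx'
  obtain ⟨u₀, hu₀⟩ := exists_evalAt_eq_single hg
  have hu₀' : LinearIndependent ℝ fun i => evalAt u₀ (g i) := by
    have h1 : (fun i => evalAt u₀ (g i)) = Pi.basisFun ℝ (Fin n) := by
      ext1 i; rw [hu₀, Pi.basisFun_apply]
    rw [h1]
    exact (Pi.basisFun ℝ (Fin n)).linearIndependent
  obtain ⟨i, hi⟩ := hU.exists_mem_open (isOpen_linearIndependent_evalAt g) ⟨u₀, hu₀'⟩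
  obtain ⟨M, hM⟩ := exists_affineSpan_image_inter_closedBall_eq_top
    (affineSpan_image_evalAt_eq_top hne hgT hi)
  have hint := interior_convexHull_nonempty_iff_affineSpan_eq_top.2 (hM M le_rfl)
  obtain ⟨k, hk⟩ := hQ.exists_mem_open isOpen_interior hint
  obtain ⟨ε, hε, hball⟩ := Metric.isOpen_iff.1 isOpen_interior _ hk
  obtain ⟨m, hm⟩ := exists_nat_one_div_lt hε
  obtain ⟨m', hm'⟩ := exists_nat_ge ‖x‖
  -- A single index bounds the functionals, the point and the inverse radius.
  obtain ⟨N, hNM, hNm, hNm'⟩ : ∃ N : ℕ, (M : ℝ) ≤ N ∧ (m : ℝ) ≤ N ∧ (m' : ℝ) ≤ N :=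
    ⟨M + m + m', by exact_mod_cast (by omega : M ≤ M + m + m'),
      by exact_mod_cast (by omega : m ≤ M + m + m'), by exact_mod_cast (by omega : m' ≤ M + m + m')⟩
  refine Set.mem_iUnion.2 ⟨(i, k, N), hm'.trans hNm', ?_⟩
  have h1 : (1 : ℝ) / (N + 1) < ε :=
    (one_div_le_one_div_of_le (by positivity) (by linarith)).trans_lt hm
  refine (Metric.closedBall_subset_ball h1).trans (hball.trans (interior_subset.trans ?_))
  exact convexHull_mono (Set.image_mono (Set.inter_subset_inter_right _
    (Metric.closedBall_subset_closedBall hNM)))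

theorem exists_closed_bounded_coneBound_cover [TopologicalSpace.SeparableSpace X] (hn : 0 < n)
    {T : X → Set (StrongDual ℝ X)} (hT : IsMonotoneOperator T) :
    ∃ D : ℕ → Set X, multiplicitySet T n ⊆ ⋃ i, D i ∧
      ∀ i, IsClosed (D i) ∧ Bornology.IsBounded (D i) ∧
        ∃ (u : Fin n → X) (L : ℝ), 0 ≤ L ∧ ConeBound u L (D i) := by
  obtain ⟨e, he⟩ := exists_surjective_nat (ℕ × ℕ × ℕ)
  let U := TopologicalSpace.denseSeq (Fin n → X)
  let Q := TopologicalSpace.denseSeq (Fin n → ℝ)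
  refine ⟨fun i => closure (ballSet T (U (e i).1) (Q (e i).2.1) (1 / ((e i).2.2 + 1)) (e i).2.2),
    ?_, fun i => ⟨isClosed_closure, ?_, U (e i).1, (e i).2.2 / (1 / ((e i).2.2 + 1)), by positivity,
      (coneBound_ballSet hT _ _ (by positivity) (by positivity)).closure⟩⟩
  · refine (multiplicitySet_subset_iUnion_ballSet hn T
      (TopologicalSpace.denseRange_denseSeq (Fin n → X))
      (TopologicalSpace.denseRange_denseSeq (Fin n → ℝ))).trans ?_
    rw [← he.iUnion_comp]
    exact Set.iUnion_mono fun i => subset_closure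
  · exact (isBounded_iff_forall_norm_le.2 ⟨_, fun x hx => hx.1⟩).closure

end Cover

/-! ### Projecting the pieces: closedness and the dimension count. -/

section Image

variable {X : Type*} [NormedAddCommGroup X] [NormedSpace ℝ X]
  {Y : Type*} [NormedAddCommGroup Y] [NormedSpace ℝ Y] {n : ℕ}

/-- A surjection of Banach spaces with finite-dimensional kernel maps bounded closed sets to
closed sets. -/
theorem isClosed_image_of_finiteDimensional_ker [CompleteSpace X] [CompleteSpace Y]
    {P : X →L[ℝ] Y} (hP : Function.Surjective P)
    [FiniteDimensional ℝ (LinearMap.ker (P : X →ₗ[ℝ] Y))] {D : Set X} (hD : IsClosed D)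
    (hb : Bornology.IsBounded D) : IsClosed (P '' D) := by
  obtain ⟨C, hC, hlift⟩ := P.exists_preimage_norm_le hP
  choose s hs hsn using hlift
  refine isSeqClosed_iff_isClosed.1 fun y z hy hz => ?_
  choose x hxD hxy using hy
  -- Subtracting norm-controlled lifts leaves a bounded sequence in the finite-dimensional kernel,
  -- where compactness applies.
  let κ : ℕ → LinearMap.ker (P : X →ₗ[ℝ] Y) := fun i =>
    ⟨x i - s z - s (y i - z), by simp [LinearMap.mem_ker, hs, hxy]⟩
  have hs0 : Filter.Tendsto (fun i => s (y i - z)) Filter.atTop (nhds 0) := by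
    refine squeeze_zero_norm (fun i => hsn _) ?_
    have h1 : Filter.Tendsto (fun i => ‖y i - z‖) Filter.atTop (nhds 0) :=
      tendsto_iff_norm_sub_tendsto_zero.1 hz
    simpa using h1.const_mul C
  have hκb : Bornology.IsBounded (Set.range κ) := by
    obtain ⟨R, hR⟩ := hb.exists_norm_le
    obtain ⟨R', hR'⟩ := hs0.norm.bddAbove_range
    refine isBounded_iff_forall_norm_le.2 ⟨R + ‖s z‖ + R', ?_⟩
    rintro _ ⟨i, rfl⟩
    have h1 : ‖s (y i - z)‖ ≤ R' := hR' ⟨i, rfl⟩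
    have h2 := hR _ (hxD i)
    calc ‖κ i‖ = ‖x i - s z - s (y i - z)‖ := rfl
      _ ≤ ‖x i - s z‖ + ‖s (y i - z)‖ := norm_sub_le _ _
      _ ≤ ‖x i‖ + ‖s z‖ + ‖s (y i - z)‖ := by gcongr; exact norm_sub_le _ _
      _ ≤ R + ‖s z‖ + R' := by gcongr
  have := FiniteDimensional.proper_real (LinearMap.ker (P : X →ₗ[ℝ] Y))
  obtain ⟨k, -, φ, hφ, hk⟩ := tendsto_subseq_of_bounded hκb fun i => Set.mem_range_self i
  have hx : Filter.Tendsto (fun i => x (φ i)) Filter.atTop (nhds ((k : X) + s z + 0)) := by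
    have h1 := ((continuous_subtype_val.tendsto k).comp hk).add_const (s z)
    refine (h1.add (hs0.comp hφ.tendsto_atTop)).congr fun i => ?_
    simp only [κ, Function.comp_apply]
    abel
  refine ⟨_, hD.mem_of_tendsto hx (Filter.Eventually.of_forall fun i => hxD _), ?_⟩
  have hk0 : P k = 0 := k.2
  simp [hs, hk0]

/-- The part of a `ConeBound` set in a translate of a finite-dimensional subspace `U` containing
the vectors `u j` has Hausdorff dimension at most `dim U - n`. -/
theorem ConeBound.dimH_le {u : Fin n → X} {L : ℝ} {A : Set X} (h : ConeBound u L A)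
    (hL : 0 ≤ L) (U : Submodule ℝ X) [FiniteDimensional ℝ U] (hu : ∀ j, u j ∈ U)
    (hA : ∀ x ∈ A, ∀ y ∈ A, x - y ∈ U) :
    dimH A + n ≤ Module.finrank ℝ U ∨ A = ∅ := by
  -- For empty `A` the vectors `u` may be dependent and `n` may exceed `dim U`.
  rcases A.eq_empty_or_nonempty with hemp | hne
  · exact Or.inr hemp
  left
  have hind := h.linearIndependent hne
  obtain ⟨x₀, hx₀⟩ := hne
  let V : Submodule ℝ X := Submodule.span ℝ (Set.range u)
  have hVU : V ≤ U := Submodule.span_le.2 (Set.range_subset_iff.2 hu)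
  obtain ⟨Q, hdisj, hsup⟩ : ∃ Q : Submodule ℝ X, V ⊓ Q = ⊥ ∧ V ⊔ Q = U := by
    obtain ⟨Q, h1, h2⟩ := exists_isCompl V
    refine ⟨Q ⊓ U, ?_, ?_⟩
    · rw [← inf_assoc, h1.eq_bot, bot_inf_eq]
    · rw [← sup_inf_assoc_of_le Q hVU, h2.eq_top, top_inf_eq]
  have hQU : Q ≤ U := hsup ▸ le_sup_right
  have : FiniteDimensional ℝ Q := Submodule.finiteDimensional_of_le hQU
  have : FiniteDimensional ℝ V := Submodule.finiteDimensional_of_le hVU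
  have hdim : Module.finrank ℝ Q + n = Module.finrank ℝ U := by
    have h1 := Submodule.finrank_sup_add_finrank_inf_eq V Q
    rw [hdisj, hsup, finrank_bot, finrank_span_eq_card hind, Fintype.card_fin] at h1
    omega
  have hdec : ∀ x : A, ∃ (z : Q) (c : Fin n → ℝ), (x : X) - x₀ = (z : X) + ∑ j, c j • u j := by
    intro x
    have h1 : (x : X) - x₀ ∈ V ⊔ Q := hsup ▸ hA x x.2 x₀ hx₀
    obtain ⟨v, hv, z, hz, hvz⟩ := Submodule.mem_sup.1 h1
    obtain ⟨c, rfl⟩ := (Submodule.mem_span_range_iff_exists_fun ℝ).1 hv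
    exact ⟨⟨z, hz⟩, c, by rw [← hvz, add_comm]⟩
  choose z c hzc using hdec
  obtain ⟨M, hM⟩ := (Set.finite_range fun j => ‖u j‖).bddAbove
  have hM' : ∀ j, ‖u j‖ ≤ |M| := fun j => (hM ⟨j, rfl⟩).trans (le_abs_self M)
  -- The cone bound controls the `u`-coordinates of a difference by its `Q`-component, so projecting
  -- `A` to `Q` has a Lipschitz inverse.
  have hanti : AntilipschitzWith (Real.toNNReal (1 + n * |M| * L)) z := by
    refine AntilipschitzWith.of_le_mul_dist fun x y => ?_
    have e1 : (x : X) - y - ∑ j, (c x - c y) j • u j = ((z x - z y : Q) : X) := by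
      have h1 := hzc x
      have h2 := hzc y
      have h3 : (x : X) - y = ((x : X) - x₀) - (y - x₀) := by abel
      rw [h3, h1, h2]
      simp only [Pi.sub_apply, sub_smul, Finset.sum_sub_distrib, Submodule.coe_sub]
      abel
    have e2 := h x x.2 y y.2 (c x - c y)
    rw [e1] at e2
    have e3 := norm_sum_smul_le hM' (c x - c y)
    have e4 : ‖(x : X) - y‖ ≤ ‖((z x - z y : Q) : X)‖ + ‖∑ j, (c x - c y) j • u j‖ := by
      rw [← e1]; exact norm_le_norm_sub_add _ _
    rw [Real.coe_toNNReal _ (by positivity), Subtype.dist_eq, dist_eq_norm, dist_eq_norm]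
    have e5 : ‖((z x - z y : Q) : X)‖ = ‖z x - z y‖ := rfl
    rw [e5] at e2 e4
    have e6 := mul_le_mul_of_nonneg_left e2 (by positivity : 0 ≤ (n : ℝ) * |M|)
    linarith
  have hle := hanti.dimH_preimage_le Set.univ
  have hAdim : dimH A = dimH (Set.univ : Set A) := by
    have := (isometry_subtype_coe (s := A)).dimH_image Set.univ
    rwa [Set.image_univ, Subtype.range_coe] at this
  rw [Set.preimage_univ, ← hAdim, Real.dimH_univ_eq_finrank] at hle
  rw [← hdim]
  push_cast
  gcongr

variable [MeasurableSpace Y] [BorelSpace Y]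

/-- The part of `A` over a translate of `W` has differences in `U`, with `dim U ≤ dim W + dim ker P
< dim W + n`. Its Hausdorff dimension is thus below `dim W`, and the Lipschitz map `P` does not
raise it. -/
theorem ConeBound.image_mem_classA {u : Fin n → X} {L : ℝ} {A : Set X} (h : ConeBound u L A)
    (hL : 0 ≤ L) {P : X →L[ℝ] Y} (hP : Function.Surjective P)
    [FiniteDimensional ℝ (LinearMap.ker (P : X →ₗ[ℝ] Y))]
    (hker : Module.finrank ℝ (LinearMap.ker (P : X →ₗ[ℝ] Y)) < n)
    (hm : MeasurableSet (P '' A)) (W : Submodule ℝ Y) [FiniteDimensional ℝ W]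
    (hu : ∀ j, P (u j) ∈ W) : P '' A ∈ classA W := by
  refine ⟨hm, fun a => ?_⟩
  obtain ⟨s, hs⟩ := (P : X →ₗ[ℝ] Y).exists_rightInverse_of_surjective
    (LinearMap.range_eq_top.2 hP)
  have hs' : ∀ y, P (s y) = y := fun y => LinearMap.congr_fun hs y
  let U : Submodule ℝ X := W.map s ⊔ LinearMap.ker (P : X →ₗ[ℝ] Y)
  have hU : ∀ x, P x ∈ W → x ∈ U := fun x hx =>
    Submodule.mem_sup.2 ⟨s (P x), Submodule.mem_map_of_mem hx, x - s (P x),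
      by simp [LinearMap.mem_ker, hs'], by abel⟩
  have hUdim : Module.finrank ℝ U < Module.finrank ℝ W + n := by
    have h1 := Submodule.finrank_add_le_finrank_add_finrank (W.map s)
      (LinearMap.ker (P : X →ₗ[ℝ] Y))
    have h2 := Submodule.finrank_map_le s W
    change Module.finrank ℝ U ≤ _ at h1
    omega
  let F : Set X := {x ∈ A | P x + a ∈ W}
  have hF : ConeBound u L F := fun x hx y hy => h x hx.1 y hy.1
  have hFU : ∀ x ∈ F, ∀ y ∈ F, x - y ∈ U := fun x hx y hy => hU _ (by
    have h1 := W.sub_mem hx.2 hy.2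
    rwa [add_sub_add_right_eq_sub, ← map_sub] at h1)
  let f : F → W := fun x => ⟨P x + a, x.2.2⟩
  have hf : LipschitzWith ‖P‖₊ f := LipschitzWith.of_dist_le_mul fun x y => by
    have h1 := P.lipschitz.dist_le_mul x y
    simpa [f, Subtype.dist_eq] using h1
  have hsub : ((↑) : W → Y) ⁻¹' ((fun b : Y => b + a) '' (P '' A)) ⊆ Set.range f := by
    rintro w ⟨_, ⟨x, hx, rfl⟩, hxw⟩
    have hxw' : P x + a = w := hxw
    exact ⟨⟨x, hx, hxw' ▸ w.2⟩, Subtype.ext hxw'⟩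
  refine measure_mono_null hsub ?_
  rcases hF.dimH_le hL U (fun j => hU _ (hu j)) hFU with hdim | hemp
  · have hFdim : dimH F = dimH (Set.univ : Set F) := by
      have := (isometry_subtype_coe (s := F)).dimH_image Set.univ
      rwa [Set.image_univ, Subtype.range_coe] at this
    have hlt : dimH (Set.range f) < ((Module.finrank ℝ W : NNReal) : ENNReal) := by
      refine hf.dimH_range_le.trans_lt ?_
      rw [← hFdim]
      have h1 : dimH F + n < (Module.finrank ℝ W : ENNReal) + n :=
        hdim.trans_lt (by exact_mod_cast hUdim)
      simpa using lt_of_add_lt_add_right h1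
    have h0 := hausdorffMeasure_of_dimH_lt hlt
    exact Measure.absolutelyContinuous_isAddHaarMeasure Measure.addHaar
      (Measure.hausdorffMeasure (Module.finrank ℝ W : ℝ)) h0
  · have : IsEmpty F := Set.isEmpty_coe_sort.2 hemp
    simp [Set.range_eq_empty]

/-- Lifting the small errors `P (u j) - w j` to `X` moves `u` slightly to vectors mapped exactly
into `W`. -/
theorem ConeBound.exists_image_mem_classA [CompleteSpace X] [CompleteSpace Y]
    {u : Fin n → X} {L : ℝ} {A : Set X} (h : ConeBound u L A)
    (hL : 0 ≤ L) {P : X →L[ℝ] Y} (hP : Function.Surjective P)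
    [FiniteDimensional ℝ (LinearMap.ker (P : X →ₗ[ℝ] Y))]
    (hker : Module.finrank ℝ (LinearMap.ker (P : X →ₗ[ℝ] Y)) < n)
    (hm : MeasurableSet (P '' A)) :
    ∃ η > 0, ∀ (W : Submodule ℝ Y) [FiniteDimensional ℝ W],
      (∀ j, ∃ w ∈ W, ‖P (u j) - w‖ < η) → P '' A ∈ classA W := by
  obtain ⟨C, hC, hlift⟩ := P.exists_preimage_norm_le hP
  choose s hs hsn using hlift
  set δ : ℝ := 1 / (2 * (L * n + 1)) with hδ
  have hδ0 : 0 < δ := by positivity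
  refine ⟨δ / C, by positivity, fun W _ hW => ?_⟩
  choose w hwW hw using hW
  let u' : Fin n → X := fun j => u j - s (P (u j) - w j)
  have hu' : ∀ j, ‖u' j - u j‖ ≤ δ := fun j => by
    have h1 : u' j - u j = -s (P (u j) - w j) := by simp [u']
    rw [h1, norm_neg]
    refine (hsn _).trans ?_
    have := (lt_div_iff₀ hC).1 (hw j)
    linarith
  have hδL : L * (n * δ) ≤ 1 / 2 := by
    rw [hδ, ← mul_assoc, mul_one_div, div_le_div_iff₀ (by positivity) (by positivity)]
    linarith
  refine (h.perturb hL hδL hu').image_mem_classA (by positivity) hP hker hm W fun j => ?_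
  simpa [u', hs] using hwW j

end Image

/-! ### Directional null sets and their Fubini decomposition. -/

section Aronszajn

variable {Y : Type*} [NormedAddCommGroup Y] [NormedSpace ℝ Y] [MeasurableSpace Y] [BorelSpace Y]

theorem mem_classA_iff {V : Submodule ℝ Y} [FiniteDimensional ℝ V] {B : Set Y} :
    B ∈ classA V ↔ MeasurableSet B ∧
      ∀ a : Y, ∀ᵐ w : V ∂Measure.addHaar, a + (w : Y) ∉ B := by
  refine and_congr_right fun _ => ?_
  have h1 : ∀ a : Y, ((↑) : V → Y) ⁻¹' ((fun b : Y => b + a) '' B)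
      = {w : V | ¬ (-a + (w : Y) ∉ B)} := by
    intro a
    ext w
    rw [Set.image_add_right]
    simp only [Set.mem_preimage, Set.mem_ofPred_eq, not_not, add_comm]
  constructor
  · intro h a
    have h2 := h (-a)
    rw [h1, neg_neg] at h2
    exact h2
  · intro h a
    rw [h1]
    exact h (-a)

theorem empty_mem_classA (V : Submodule ℝ Y) [FiniteDimensional ℝ V] : ∅ ∈ classA V :=
  mem_classA_iff.2 ⟨MeasurableSet.empty, fun _ => by simp⟩

theorem iUnion_mem_classA {V : Submodule ℝ Y} [FiniteDimensional ℝ V] {B : ℕ → Set Y}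
    (h : ∀ i, B i ∈ classA V) : ⋃ i, B i ∈ classA V := by
  refine mem_classA_iff.2 ⟨MeasurableSet.iUnion fun i => (h i).1, fun a => ?_⟩
  simp only [Set.mem_iUnion, not_exists]
  exact ae_all_iff.2 fun i => (mem_classA_iff.1 (h i)).2 a

theorem union_mem_classA {V : Submodule ℝ Y} [FiniteDimensional ℝ V] {B C : Set Y}
    (hB : B ∈ classA V) (hC : C ∈ classA V) : B ∪ C ∈ classA V := by
  refine mem_classA_iff.2 ⟨hB.1.union hC.1, fun a => ?_⟩
  filter_upwards [(mem_classA_iff.1 hB).2 a, (mem_classA_iff.1 hC).2 a] with w h1 h2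
  simp [h1, h2]

theorem interior_eq_empty_of_mem_classA {V : Submodule ℝ Y} [FiniteDimensional ℝ V] {B : Set Y}
    (hB : B ∈ classA V) : interior B = ∅ := by
  by_contra hne
  obtain ⟨a, ha⟩ := Set.nonempty_iff_ne_empty.2 hne
  have hopen : IsOpen {w : V | a + (w : Y) ∈ interior B} :=
    isOpen_interior.preimage (continuous_const.add continuous_subtype_val)
  refine (hopen.measure_pos Measure.addHaar ⟨0, by simpa using ha⟩).ne'
    (measure_mono_null ?_ ((mem_classA_iff.1 hB).2 a))
  intro w hw
  simpa using interior_subset hw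

theorem eq_empty_of_mem_classA_bot {B : Set Y} {V : Submodule ℝ Y} [FiniteDimensional ℝ V]
    (hV : V = ⊥) (hB : B ∈ classA V) : B = ∅ := by
  subst hV
  refine Set.eq_empty_of_forall_notMem fun a => ?_
  obtain ⟨w, hw⟩ := ((mem_classA_iff.1 hB).2 a).exists
  have hw0 : (w : Y) = 0 := (Submodule.mem_bot ℝ).1 w.2
  simpa [hw0] using hw

/-- A set which is null along `W ⊔ S` splits into a set null along `S` and a set null along `W`. -/
theorem exists_union_eq_of_mem_classA_sup [SecondCountableTopology Y] (W S : Submodule ℝ Y)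
    [FiniteDimensional ℝ W] [FiniteDimensional ℝ S] {B : Set Y}
    (hB : B ∈ classA (W ⊔ S : Submodule ℝ Y)) :
    ∃ B₁ ∈ classA W, ∃ B₂ ∈ classA S, B = B₁ ∪ B₂ := by
  obtain ⟨hm, hnull⟩ := mem_classA_iff.1 hB
  -- `G` collects the points whose `S`-slice of `B` is null. Fubini makes `B \ G` null along `W`; `B
  -- ∩ G` is null along `S`.
  set G : Set Y := {x | ∀ᵐ s : S ∂Measure.addHaar, x + (s : Y) ∉ B} with hG
  have hGm : MeasurableSet G := by
    have h1 : MeasurableSet {p : Y × S | p.1 + (p.2 : Y) ∈ B} :=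
      (measurable_fst.add (measurable_subtype_coe.comp measurable_snd)) hm
    have h2 := measurable_measure_prodMk_left (ν := (Measure.addHaar : Measure S)) h1
    have h3 : G = (fun x : Y => (Measure.addHaar : Measure S)
        (Prod.mk x ⁻¹' {p : Y × S | p.1 + (p.2 : Y) ∈ B})) ⁻¹' {0} := by
      ext x
      simp [hG, ae_iff, Set.preimage]
    rw [h3]
    exact h2 (measurableSet_singleton 0)
  refine ⟨B \ G, mem_classA_iff.2 ⟨hm.diff hGm, fun a => ?_⟩, B ∩ G,
    mem_classA_iff.2 ⟨hm.inter hGm, fun a => ?_⟩, by rw [Set.union_comm, Set.inter_union_sdiff]⟩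
  -- `W` and `S` may intersect; a surjective linear map still pulls conull sets back to conull sets.
  · let l : W × S →ₗ[ℝ] (W ⊔ S : Submodule ℝ Y) :=
      (Submodule.inclusion le_sup_left).coprod (Submodule.inclusion le_sup_right)
    have hl : Function.Surjective l := by
      rintro ⟨x, hx⟩
      obtain ⟨w, hw, s, hs, rfl⟩ := Submodule.mem_sup.1 hx
      exact ⟨(⟨w, hw⟩, ⟨s, hs⟩), rfl⟩
    have hlm : MeasurableSet {x : (W ⊔ S : Submodule ℝ Y) | a + (x : Y) ∉ B} :=
      (measurable_const.add measurable_subtype_coe) hm.compl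
    have h1 := (ae_comp_linearMap_mem_iff l
      ((Measure.addHaar : Measure W).prod (Measure.addHaar : Measure S)) Measure.addHaar
      hl hlm).2 (hnull a)
    filter_upwards [Measure.ae_ae_of_ae_prod h1] with w hw hwB
    refine hwB.2 ?_
    filter_upwards [hw] with s hs
    have hs' : a + ((w : Y) + (s : Y)) ∉ B := hs
    rwa [← add_assoc] at hs'
  -- One point of `G` on the coset `a + S` makes the whole slice null, by translation invariance.
  · by_cases hex : ∃ s₀ : S, a + (s₀ : Y) ∈ B ∩ G
    · obtain ⟨s₀, hs₀⟩ := hex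
      have h1 : ∀ᵐ s : S ∂Measure.addHaar, a + ((s₀ + s : S) : Y) ∉ B := by
        filter_upwards [hs₀.2] with s hs
        rwa [Submodule.coe_add, ← add_assoc]
      have h2 := (eventually_add_left_iff (Measure.addHaar : Measure S) s₀
        (p := fun s : S => a + (s : Y) ∉ B)).1 h1
      filter_upwards [h2] with s hs hs'
      exact hs hs'.1
    · exact Filter.Eventually.of_forall fun s hs => hex ⟨s, hs⟩

theorem exists_iUnion_eq_of_mem_classA_span [SecondCountableTopology Y] (v : ℕ → Y) (N : ℕ)
    (W : Submodule ℝ Y) [FiniteDimensional ℝ W] (hW : W = Submodule.span ℝ (v '' Set.Iio N))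
    {B : Set Y} (hB : B ∈ classA W) :
    ∃ C : ℕ → Set Y, (∀ k, C k ∈ classA (Submodule.span ℝ {v k})) ∧ B = ⋃ k, C k := by
  induction N generalizing W B with
  | zero =>
    refine ⟨fun _ => ∅, fun k => empty_mem_classA _, ?_⟩
    rw [eq_empty_of_mem_classA_bot (by simpa using hW) hB]
    simp
  | succ N ih =>
    have hfin : FiniteDimensional ℝ (Submodule.span ℝ (v '' Set.Iio N)) :=
      FiniteDimensional.span_of_finite ℝ ((Set.finite_Iio N).image v)
    have hW' : W = Submodule.span ℝ (v '' Set.Iio N) ⊔ Submodule.span ℝ {v N} := by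
      rw [hW, ← Submodule.span_union, ← Set.image_singleton, ← Set.image_union]
      congr 2
      ext k
      simp only [Set.mem_Iio, Set.mem_union, Set.mem_singleton_iff]
      omega
    subst hW'
    obtain ⟨B₁, hB₁, B₂, hB₂, rfl⟩ := exists_union_eq_of_mem_classA_sup _ _ hB
    obtain ⟨C, hC, rfl⟩ := ih _ rfl hB₁
    refine ⟨fun k => C k ∪ {y ∈ B₂ | k = N}, fun k => union_mem_classA (hC k) ?_, ?_⟩
    · by_cases hk : k = N
      · subst hk; simpa using hB₂
      · simpa [hk] using empty_mem_classA _
    · rw [Set.iUnion_union_distrib]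
      congr 1
      ext y
      simp

end Aronszajn

/-! ### Approximating and enlarging subspaces. -/

section Subspaces

variable {Y : Type*} [NormedAddCommGroup Y] [NormedSpace ℝ Y]

theorem exists_span_image_Iio_approx {v : ℕ → Y}
    (hv : Dense (Submodule.span ℝ (Set.range v) : Set Y)) {n : ℕ} (y : Fin n → Y) {η : ℝ}
    (hη : 0 < η) :
    ∃ N : ℕ, ∀ j, ∃ w ∈ Submodule.span ℝ (v '' Set.Iio N), ‖y j - w‖ < η := by
  have h1 : ∀ j, ∃ N : ℕ, ∃ w ∈ Submodule.span ℝ (v '' Set.Iio N), ‖y j - w‖ < η := by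
    intro j
    obtain ⟨w, hw, hd⟩ := hv.exists_dist_lt (y j) hη
    have h2 : Set.range v = ⋃ N : ℕ, v '' Set.Iio N := by
      rw [← Set.image_iUnion, Set.iUnion_Iio, Set.image_univ]
    have hmono : Monotone fun N : ℕ => Submodule.span ℝ (v '' Set.Iio N) := fun a b hab =>
      Submodule.span_mono (Set.image_mono (Set.Iio_subset_Iio hab))
    rw [SetLike.mem_coe, h2, Submodule.span_iUnion,
      Submodule.mem_iSup_of_directed _ hmono.directed_le] at hw
    obtain ⟨N, hN⟩ := hw
    exact ⟨N, w, hN, by rwa [← dist_eq_norm]⟩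
  choose N w hw hd using h1
  exact ⟨Finset.univ.sup N, fun j => ⟨w j, Submodule.span_mono (Set.image_mono
    (Set.Iio_subset_Iio (Finset.le_sup (Finset.mem_univ j)))) (hw j), hd j⟩⟩

theorem exists_norm_sub_le_of_gap_lt {V W : Submodule ℝ Y} {ε : ℝ} (h : gap V W < ε)
    {y : Y} (hy : y ∈ V) : ∃ w ∈ W, ‖y - w‖ ≤ ε * ‖y‖ := by
  rcases eq_or_ne y 0 with rfl | hy0
  · exact ⟨0, W.zero_mem, by simp⟩
  have hpos : 0 < ‖y‖ := norm_pos_iff.2 hy0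
  have hbdd : BddAbove ((fun y : Y => Metric.infDist y (W : Set Y)) '' {y | y ∈ V ∧ ‖y‖ = 1}) := by
    refine ⟨1, ?_⟩
    rintro _ ⟨z, ⟨-, hz⟩, rfl⟩
    simpa [hz] using Metric.infDist_le_dist_of_mem (x := z) W.zero_mem
  have h1 : Metric.infDist (‖y‖⁻¹ • y) (W : Set Y) < ε :=
    (le_csSup hbdd ⟨‖y‖⁻¹ • y, ⟨V.smul_mem _ hy, by
      rw [norm_smul, norm_inv, norm_norm, inv_mul_cancel₀ hpos.ne']⟩, rfl⟩).trans_lt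
      ((le_max_left _ _).trans_lt h)
  obtain ⟨w, hw, hd⟩ := (Metric.infDist_lt_iff ⟨0, W.zero_mem⟩).1 h1
  refine ⟨‖y‖ • w, W.smul_mem _ hw, ?_⟩
  have h2 : y - ‖y‖ • w = ‖y‖ • (‖y‖⁻¹ • y - w) := by
    rw [smul_sub, smul_inv_smul₀ hpos.ne']
  rw [h2, norm_smul, norm_norm, mul_comm, ← dist_eq_norm]
  exact mul_le_mul_of_nonneg_right hd.le hpos.le

/-- In an infinite-dimensional space, every subspace of dimension at most `n` is contained in one
of dimension `n`. -/
theorem exists_le_finrank_eq (hY : ¬ FiniteDimensional ℝ Y) (n : ℕ) (V : Submodule ℝ Y)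
    [FiniteDimensional ℝ V] (hV : Module.finrank ℝ V ≤ n) :
    ∃ V' : Submodule ℝ Y, V ≤ V' ∧ FiniteDimensional ℝ V' ∧ Module.finrank ℝ V' = n := by
  induction n, hV using Nat.le_induction with
  | base => exact ⟨V, le_rfl, inferInstance, rfl⟩
  | succ m hm ih =>
    obtain ⟨V', hle, hfin, hdim⟩ := ih
    have hne : V' ≠ ⊤ := by
      rintro rfl
      exact hY (Module.Finite.equiv (Submodule.topEquiv : (⊤ : Submodule ℝ Y) ≃ₗ[ℝ] Y))
    obtain ⟨y, hy⟩ := SetLike.exists_not_mem_of_ne_top V' hne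
    refine ⟨V' ⊔ Submodule.span ℝ {y}, hle.trans le_sup_left, inferInstance, ?_⟩
    have hy0 : y ≠ 0 := fun h => hy (h ▸ V'.zero_mem)
    have h1 := Submodule.finrank_sup_add_finrank_inf_eq V' (Submodule.span ℝ {y})
    rw [((Submodule.disjoint_span_singleton' hy0).2 hy).eq_bot, finrank_bot,
      finrank_span_singleton hy0] at h1
    omega

theorem not_finiteDimensional_of_ker {X : Type*} [NormedAddCommGroup X] [NormedSpace ℝ X]
    {P : X →L[ℝ] Y} (hX : ¬ FiniteDimensional ℝ X)
    [FiniteDimensional ℝ (LinearMap.ker (P : X →ₗ[ℝ] Y))] : ¬ FiniteDimensional ℝ Y := by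
  intro hY
  apply hX
  have : IsNoetherian ℝ X := isNoetherian_of_range_eq_ker
    (LinearMap.ker (P : X →ₗ[ℝ] Y)).subtype (P : X →ₗ[ℝ] Y) (by simp)
  infer_instance

end Subspaces

/-! ### Membership in the gap class, and the theorem. -/

section Main

variable {X : Type*} [NormedAddCommGroup X] [NormedSpace ℝ X] [CompleteSpace X]
  {Y : Type*} [NormedAddCommGroup Y] [NormedSpace ℝ Y] [CompleteSpace Y]
  [MeasurableSpace Y] [BorelSpace Y] {n : ℕ}

theorem ConeBound.exists_image_mem_classAStar (hY : ¬ FiniteDimensional ℝ Y)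
    {u : Fin n → X} {L : ℝ} {A : Set X} (h : ConeBound u L A) (hL : 0 ≤ L)
    {P : X →L[ℝ] Y} (hP : Function.Surjective P)
    [FiniteDimensional ℝ (LinearMap.ker (P : X →ₗ[ℝ] Y))]
    (hker : Module.finrank ℝ (LinearMap.ker (P : X →ₗ[ℝ] Y)) < n)
    (hm : MeasurableSet (P '' A)) :
    ∃ V : Submodule ℝ Y, FiniteDimensional ℝ V ∧ Module.finrank ℝ V = n ∧
      P '' A ∈ classAStar V := by
  obtain ⟨η, hη, hnear⟩ := h.exists_image_mem_classA hL hP hker hm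
  have hfin : FiniteDimensional ℝ (Submodule.span ℝ (Set.range fun j => P (u j))) :=
    FiniteDimensional.span_of_finite ℝ (Set.finite_range _)
  -- The `P (u j)` may be dependent, so their span is padded to dimension `n`.
  obtain ⟨V, hle, hVfin, hVdim⟩ := exists_le_finrank_eq hY n
    (Submodule.span ℝ (Set.range fun j => P (u j)))
    ((finrank_range_le_card _).trans (by simp))
  refine ⟨V, hVfin, hVdim, ?_⟩
  obtain ⟨M, hM⟩ := (Set.finite_range fun j => ‖P (u j)‖).bddAbove
  have hM' : ∀ j, ‖P (u j)‖ ≤ |M| := fun j => (hM ⟨j, rfl⟩).trans (le_abs_self M)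
  -- A gap below `ε` moves each `P (u j)` by at most `ε * |M| < η`; the added `1` makes this strict.
  set ε : ℝ := min (1 / 2) (η / (|M| + 1)) with hε
  have hε0 : 0 < ε := by positivity
  have hεη : ε * (|M| + 1) ≤ η := (le_div_iff₀ (by positivity)).1 (min_le_right _ _)
  have hε1 : ε < 1 := (min_le_left _ _).trans_lt (by norm_num)
  refine ⟨fun _ => P '' A, fun _ => ε, fun _ => ⟨hε0, hε1, hm, fun W _ hW => ?_⟩,
    (Set.iUnion_const _).symm⟩
  refine hnear W fun j => ?_
  obtain ⟨w, hw, hwle⟩ := exists_norm_sub_le_of_gap_lt hW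
    (hle (Submodule.subset_span ⟨j, rfl⟩) : P (u j) ∈ V)
  refine ⟨w, hw, hwle.trans_lt ?_⟩
  have := mul_le_mul_of_nonneg_left (hM' j) hε0.le
  linarith

end Main
end MonotoneProjection

theorem theorem4 {X : Type*} [NormedAddCommGroup X] [NormedSpace ℝ X] [CompleteSpace X]
    [TopologicalSpace.SeparableSpace X] (hX : ¬ FiniteDimensional ℝ X)
    {Y : Type*} [NormedAddCommGroup Y] [NormedSpace ℝ Y] [CompleteSpace Y]
    [MeasurableSpace Y] [BorelSpace Y]
    (n : ℕ) (hn : 2 ≤ n)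
    (T : X → Set (StrongDual ℝ X)) (hT : MonotoneProjection.IsMonotoneOperator T)
    (P : X →L[ℝ] Y) (hP : Function.Surjective P)
    (hker : Module.rank ℝ (LinearMap.ker (P : X →ₗ[ℝ] Y)) < (n : Cardinal)) :
    (∃ C ∈ MonotoneProjection.classCStar Y n,
        P '' MonotoneProjection.multiplicitySet T n ⊆ C) ∧
      IsMeagre (P '' MonotoneProjection.multiplicitySet T n) ∧
      ∃ N ∈ MonotoneProjection.aronszajnNull Y,
        P '' MonotoneProjection.multiplicitySet T n ⊆ N := by
  have hfin : FiniteDimensional ℝ (LinearMap.ker (P : X →ₗ[ℝ] Y)) :=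
    Module.rank_lt_aleph0_iff.1 (hker.trans (Cardinal.natCast_lt_aleph0))
  have hker' : Module.finrank ℝ (LinearMap.ker (P : X →ₗ[ℝ] Y)) < n := by
    rw [← Module.finrank_eq_rank] at hker
    exact_mod_cast hker
  have hsep : TopologicalSpace.SeparableSpace Y :=
    hP.denseRange.separableSpace P.continuous
  have : SecondCountableTopology Y := UniformSpace.secondCountable_of_separable Y
  have hY := MonotoneProjection.not_finiteDimensional_of_ker (P := P) hX
  obtain ⟨D, hcov, hD⟩ :=
    MonotoneProjection.exists_closed_bounded_coneBound_cover (n := n) (by omega) hT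
  choose hDcl hDb u L hL hcone using hD
  have hcl : ∀ i, IsClosed (P '' D i) := fun i =>
    MonotoneProjection.isClosed_image_of_finiteDimensional_ker hP (hDcl i) (hDb i)
  have hsub : P '' MonotoneProjection.multiplicitySet T n ⊆ ⋃ i, P '' D i := by
    rw [← Set.image_iUnion]
    exact Set.image_mono hcov
  refine ⟨⟨_, ?_, hsub⟩, ?_, _, ?_, hsub⟩
  · choose V hVfin hVdim hV using fun i =>
      (hcone i).exists_image_mem_classAStar hY (hL i) hP hker' (hcl i).measurableSet
    exact ⟨_, V, fun i => ⟨hVfin i, hVdim i, hV i⟩, rfl⟩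
  · refine (isMeagre_iUnion fun i => ?_).mono hsub
    have hspan : FiniteDimensional ℝ (Submodule.span ℝ (Set.range fun j => P (u i j))) :=
      FiniteDimensional.span_of_finite ℝ (Set.finite_range _)
    refine IsNowhereDense.isMeagre ((hcl i).isNowhereDense_iff.2 ?_)
    exact MonotoneProjection.interior_eq_empty_of_mem_classA
      ((hcone i).image_mem_classA (hL i) hP hker' (hcl i).measurableSet
        (Submodule.span ℝ (Set.range fun j => P (u i j)))
        fun j => Submodule.subset_span ⟨j, rfl⟩)
  · intro v _ hv
    have hdec : ∀ i, ∃ C : ℕ → Set Y,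
        (∀ k, C k ∈ MonotoneProjection.classA (Submodule.span ℝ {v k})) ∧
          P '' D i = ⋃ k, C k := by
      intro i
      obtain ⟨η, hη, hnear⟩ :=
        (hcone i).exists_image_mem_classA (hL i) hP hker' (hcl i).measurableSet
      -- Density of the span lets finitely many `v k` approximate all `P (u i j)` within `η`.
      obtain ⟨N, hN⟩ :=
        MonotoneProjection.exists_span_image_Iio_approx hv (fun j => P (u i j)) hη
      have hspan : FiniteDimensional ℝ (Submodule.span ℝ (v '' Set.Iio N)) :=
        FiniteDimensional.span_of_finite ℝ ((Set.finite_Iio N).image v)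
      exact MonotoneProjection.exists_iUnion_eq_of_mem_classA_span v N _ rfl (hnear _ hN)
    choose C hC hCeq using hdec
    refine ⟨fun k => ⋃ i, C i k,
      fun k => MonotoneProjection.iUnion_mem_classA fun i => hC i k, ?_⟩
    simp only [hCeq]
    exact Set.iUnion_comm _
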